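/- All graphs are simple. For each $n\ge 1$ let $G_n$ be a random graph on a finite non-empty vertex set, where $n_1(n)=|V(G_n)|$ is non-random and $n_1(n)\to\infty$ as $n\to\infty$. Let $\mathcal G_*$ be the space of rooted connected locally finite graphs up to root-preserving isomorphism $\cong$, with the Borel $\sigma$-algebra of the distance $d_{loc}(G,H)=2^{-\sup\{r:\,B_r(G)\cong B_r(H)\}}$, where $B_r(G,v)$ is the subgraph of $G$ induced on the vertices at distance at most $r$ from $v$, rooted at $v$. Let $G^*$ be a random element of $\mathcal G_*$ with root $r^*$, and let $d^*$ be the degree of $r^*$ in $G^*$. Let $d_n$ be the degree in $G_n$ of a vertex chosen uniformly at random from $V(G_n)$ (given $G_n$). Suppose that $G_n$ converges to $G^*$ locally weakly in probability, that is, for every integer $r\ge 0$ and every finite rooted connected graph $H$, $$\frac{|\{v\in V(G_n): B_r(G_n,v)\cong H\}|}{n_1(n)}\xrightarrow{p}\mathbb P(B_r(G^*)\cong H).$$ Suppose moreover that $\mathbb E\, d_n^3\to\mathbb E\,(d^*)^3<\infty$, that $\mathrm{Var}(d^*)>0$, and that $\mathbb E\, d^*\,\mathbb E\,(d^*)^3-(\mathbb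 E\,(d^*)^2)^2\ne 0$ (equivalently, there is no $k$ with $d^*\in\{0,k\}$ almost surely). For a finite graph $G$ with $e(G)$ edges let $$g(G)=\frac1{2e(G)}\sum d_G(u)d_G(v),\qquad b(G)=\frac1{2e(G)}\sum d_G(u),\qquad b'(G)=\frac1{2e(G)}\sum d_G(u)^2,$$ the sums being over all $2e(G)$ ordered pairs $(u,v)$ of adjacent vertices, and let the assortativity coefficient be $$r(G)=\frac{g(G)-b(G)^2}{b'(G)-b(G)^2},$$ with $r(G)=0$ if $e(G)=0$ or $b'(G)-b(G)^2=0$. Let $\hom'(P_4',G^*,r^*)$ be the number of homomorphisms from the path $P_4$ on $4$ vertices to $G^*$ that map a fixed internal vertex of $P_4$ to $r^*$. Then $\mathbb E\hom'(P_4',G^*,r^*)<\infty$ and, as $n\to\infty$, $$r(G_n)\xrightarrow{p}\rho^*:=\frac{\mathbb E\, d^*\;\mathbb E\hom'(P_4',G^*,r^*)-(\mathbb E\,(d^*)^2)^2}{\mathbb E\, d^*\;\mathbb E\,(d^*)^3-(\mathbb E\,(d^*)^2)^2},$$ and also $\mathbb E\, r(G_n)\to\rho^*$. -/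

import Mathlib

open MeasureTheory Filter Topology ProbabilityTheory

universe u v w

/-! ### Rooted graphs, isomorphism and balls -/

/-- A rooted graph: a simple graph with a distinguished vertex. -/
structure RootedGraph where
  V : Type u
  graph : SimpleGraph V
  root : V

namespace RootedGraph

/-- Root preserving isomorphism of rooted graphs. -/
def Iso (G : RootedGraph.{u}) (H : RootedGraph.{v}) : Prop :=
  ∃ φ : G.graph ≃g H.graph, φ G.root = H.root

theorem Iso.refl (G : RootedGraph.{u}) : G.Iso G := ⟨SimpleGraph.Iso.refl, rfl⟩

theorem Iso.symm {G : RootedGraph.{u}} {H : RootedGraph.{v}} (h : G.Iso H) : H.Iso G := by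
  obtain ⟨φ, hφ⟩ := h
  exact ⟨φ.symm, by rw [← hφ]; exact φ.symm_apply_apply _⟩

theorem Iso.trans {G : RootedGraph.{u}} {H : RootedGraph.{v}} {K : RootedGraph.{w}}
    (h : G.Iso H) (k : H.Iso K) : G.Iso K := by
  obtain ⟨φ, hφ⟩ := h
  obtain ⟨ψ, hψ⟩ := k
  exact ⟨ψ.comp φ, by rw [← hψ, ← hφ]; rfl⟩

/-- `G.ball r` is `B_r(G)`: the subgraph induced on the vertices at distance at most `r` from the
root, with the same root. The extended distance `edist` is infinite between components. -/
def ball (G : RootedGraph.{u}) (r : ℕ) : RootedGraph.{u} where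
  V := {w : G.V | G.graph.edist G.root w ≤ (r : ℕ∞)}
  graph := G.graph.induce {w : G.V | G.graph.edist G.root w ≤ (r : ℕ∞)}
  root := ⟨G.root, by simp⟩

/-- Every vertex has finitely many neighbours. -/
def IsLocallyFinite (G : RootedGraph.{u}) : Prop := ∀ x : G.V, (G.graph.neighborSet x).Finite

end RootedGraph

/-- The degree `d_G(x)` of a vertex, in a graph in which this is finite. -/
noncomputable def vertexDegree {V : Type u} (G : SimpleGraph V) (x : V) : ℕ :=
  (G.neighborSet x).ncard

/-- `hom'(H', G, x)` for `H'` the graph `H` rooted at `a`: the number of homomorphisms from `H` to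
`G` that map `a` to `x` (a finite number if `H` is finite and connected and `G` locally finite). -/
noncomputable def rootedHomCount {W : Type v} {V : Type u} (H : SimpleGraph W) (a : W)
    (G : SimpleGraph V) (x : V) : ℕ :=
  Nat.card {φ : H →g G // φ a = x}

/-! ### Invariance under isomorphism -/

namespace RootedGraph

theorem edist_map_le {V : Type u} {W : Type v} {G : SimpleGraph V} {H : SimpleGraph W}
    (φ : G →g H) (x y : V) : H.edist (φ x) (φ y) ≤ G.edist x y := by
  by_cases h : G.edist x y = ⊤
  · rw [h]; exact le_top
  · obtain ⟨p, hp⟩ := SimpleGraph.exists_walk_of_edist_ne_top h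
    rw [← hp, ← SimpleGraph.Walk.length_map φ p]
    exact SimpleGraph.edist_le _

theorem edist_iso {V : Type u} {W : Type v} {G : SimpleGraph V} {H : SimpleGraph W}
    (φ : G ≃g H) (x y : V) : H.edist (φ x) (φ y) = G.edist x y := by
  refine le_antisymm (edist_map_le φ.toHom x y) ?_
  have h := edist_map_le φ.symm.toHom (φ x) (φ y)
  simpa using h

theorem Iso.ball {G : RootedGraph.{u}} {H : RootedGraph.{v}} (h : G.Iso H) (r : ℕ) :
    (G.ball r).Iso (H.ball r) := by
  obtain ⟨φ, hφ⟩ := h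
  have key : ∀ w : G.V, G.graph.edist G.root w ≤ (r : ℕ∞) ↔
      H.graph.edist H.root (φ w) ≤ (r : ℕ∞) := fun w => by rw [← hφ, edist_iso]
  exact ⟨⟨φ.toEquiv.subtypeEquiv key, φ.map_rel_iff⟩, Subtype.ext hφ⟩

theorem edist_ball (G : RootedGraph.{u}) (r : ℕ) (x : (G.ball r).V) :
    (G.ball r).graph.edist (G.ball r).root x = G.graph.edist G.root x.1 := by
  classical
  refine le_antisymm ?_ (edist_map_le (SimpleGraph.Embedding.induce _).toHom _ _)
  have hx : G.graph.edist G.root x.1 ≤ (r : ℕ∞) := x.2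
  obtain ⟨p, hp⟩ := SimpleGraph.exists_walk_of_edist_ne_top
    (ne_top_of_le_ne_top (ENat.natCast_ne_top r) hx)
  have hs : ∀ y ∈ p.support, y ∈ {w : G.V | G.graph.edist G.root w ≤ (r : ℕ∞)} := by
    intro y hy
    refine (SimpleGraph.edist_le (p.takeUntil y hy)).trans (le_trans ?_ hx)
    rw [← hp]
    exact_mod_cast p.length_takeUntil_le_length hy
  have hl : (p.induce _ hs).length = p.length := by
    have h1 := congrArg SimpleGraph.Walk.length (SimpleGraph.Walk.map_induce p hs)
    exact (SimpleGraph.Walk.length_map _ _).symm.trans h1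
  rw [← hp, ← hl]
  exact SimpleGraph.edist_le (p.induce _ hs)

theorem ball_ball (G : RootedGraph.{u}) {r s : ℕ} (h : s ≤ r) :
    ((G.ball r).ball s).Iso (G.ball s) := by
  have hsr : ((s : ℕ) : ℕ∞) ≤ (r : ℕ∞) := by exact_mod_cast h
  refine ⟨⟨⟨fun x => ⟨x.1.1, ?_⟩, fun x => ⟨⟨x.1, ?_⟩, ?_⟩, fun _ => rfl, fun _ => rfl⟩, Iff.rfl⟩,
    rfl⟩
  · exact (G.edist_ball r x.1).symm.trans_le x.2
  · exact le_trans x.2 hsr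
  · exact (G.edist_ball r ⟨x.1, le_trans x.2 hsr⟩).trans_le x.2

theorem Iso.ball_mono {G : RootedGraph.{u}} {H : RootedGraph.{v}} {r s : ℕ} (h : s ≤ r)
    (hi : (G.ball r).Iso (H.ball r)) : (G.ball s).Iso (H.ball s) :=
  (G.ball_ball h).symm.trans ((hi.ball s).trans (H.ball_ball h))

theorem Iso.degree_eq {G : RootedGraph.{u}} {H : RootedGraph.{v}} (h : G.Iso H) :
    vertexDegree G.graph G.root = vertexDegree H.graph H.root := by
  obtain ⟨φ, hφ⟩ := h
  rw [← hφ]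
  exact Nat.card_congr (φ.mapNeighborSet G.root)

theorem Iso.rootedHomCount_eq {W : Type w} (K : SimpleGraph W) (a : W)
    {G : RootedGraph.{u}} {H : RootedGraph.{v}} (h : G.Iso H) :
    rootedHomCount K a G.graph G.root = rootedHomCount K a H.graph H.root := by
  obtain ⟨φ, hφ⟩ := h
  refine Nat.card_congr ⟨fun f => ⟨φ.toHom.comp f.1, ?_⟩, fun f => ⟨φ.symm.toHom.comp f.1, ?_⟩,
    fun f => ?_, fun f => ?_⟩
  · exact (congrArg φ f.2).trans hφ
  · exact (congrArg φ.symm (f.2.trans hφ.symm)).trans (φ.symm_apply_apply _)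
  · exact Subtype.ext (RelHom.ext fun x => φ.symm_apply_apply _)
  · exact Subtype.ext (RelHom.ext fun x => φ.apply_symm_apply _)

end RootedGraph

/-! ### The space of rooted connected locally finite graphs -/

/-- Rooted connected locally finite graphs. (They are countable, so that `Type` contains a copy of
each.) -/
def LocalGraph : Type 1 :=
  {G : RootedGraph.{0} // G.graph.Connected ∧ G.IsLocallyFinite}

instance LocalGraph.setoid : Setoid LocalGraph where
  r G H := G.1.Iso H.1
  iseqv := ⟨fun G => .refl G.1, fun h => h.symm, fun h k => h.trans k⟩

/-- The space `𝒢_*` of rooted connected locally finite graphs up to root preserving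
isomorphism. -/
def GStar : Type 1 := Quotient LocalGraph.setoid

namespace GStar

/-- `B_r(x) ≅ H`. -/
def BallIso (r : ℕ) (x : GStar) (H : RootedGraph.{0}) : Prop :=
  Quotient.lift (fun G : LocalGraph => (G.1.ball r).Iso H)
    (fun _ _ (h : RootedGraph.Iso _ _) => propext ⟨fun k => (h.ball r).symm.trans k, fun k => (h.ball r).trans k⟩) x

/-- `B_r(x) ≅ B_r(y)`. -/
def BallsIso (r : ℕ) (x y : GStar) : Prop :=
  Quotient.lift₂ (fun G H : LocalGraph => (G.1.ball r).Iso (H.1.ball r))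
    (fun _ _ _ _ (h : RootedGraph.Iso _ _) (k : RootedGraph.Iso _ _) => propext
      ⟨fun l => (h.ball r).symm.trans (l.trans (k.ball r)),
        fun l => (h.ball r).trans (l.trans (k.ball r).symm)⟩) x y

/-- The degree of the root. -/
noncomputable def degree (x : GStar) : ℕ :=
  Quotient.lift (fun G : LocalGraph => vertexDegree G.1.graph G.1.root)
    (fun _ _ h => RootedGraph.Iso.degree_eq h) x

/-- `hom'(K', x, r(x))` for `K'` the graph `K` rooted at `a`. -/
noncomputable def homCount {W : Type} (K : SimpleGraph W) (a : W) (x : GStar) : ℕ :=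
  Quotient.lift (fun G : LocalGraph => rootedHomCount K a G.1.graph G.1.root)
    (fun _ _ h => RootedGraph.Iso.rootedHomCount_eq K a h) x

/-- The local distance `2 ^ (- sup {r | B_r(x) ≅ B_r(y)})`, written as the infimum of `2 ^ (- r)`
over all such `r` (so it is `0` if the supremum is infinite). -/
noncomputable def dloc (x y : GStar) : ℝ :=
  sInf ((fun r : ℕ => (1 / 2 : ℝ) ^ r) '' {r | BallsIso r x y})

theorem BallsIso.refl (r : ℕ) (x : GStar) : BallsIso r x x := by
  induction x using Quotient.inductionOn with
  | h G => exact RootedGraph.Iso.refl _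

theorem BallsIso.symm {r : ℕ} {x y : GStar} (h : BallsIso r x y) : BallsIso r y x := by
  induction x using Quotient.inductionOn with
  | h G =>
    induction y using Quotient.inductionOn with
    | h H => exact RootedGraph.Iso.symm h

theorem BallsIso.trans {r : ℕ} {x y z : GStar} (h : BallsIso r x y) (k : BallsIso r y z) :
    BallsIso r x z := by
  induction x using Quotient.inductionOn with
  | h G =>
    induction y using Quotient.inductionOn with
    | h H =>
      induction z using Quotient.inductionOn with
      | h K => exact RootedGraph.Iso.trans h k

theorem BallsIso.mono {r s : ℕ} {x y : GStar} (hs : s ≤ r) (h : BallsIso r x y) :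
    BallsIso s x y := by
  induction x using Quotient.inductionOn with
  | h G =>
    induction y using Quotient.inductionOn with
    | h H => exact RootedGraph.Iso.ball_mono hs h

theorem BallsIso.zero (x y : GStar) : BallsIso 0 x y := by
  induction x using Quotient.inductionOn with
  | h G =>
    induction y using Quotient.inductionOn with
    | h H =>
      have key : ∀ (K : RootedGraph.{0}) (a : (K.ball 0).V), a = (K.ball 0).root := by
        intro K a
        have ha : K.graph.edist K.root a.1 ≤ ((0 : ℕ) : ℕ∞) := a.2
        refine Subtype.ext ?_
        have h0 : K.graph.edist K.root a.1 = 0 := by simpa using ha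
        exact (SimpleGraph.edist_eq_zero_iff.1 h0).symm
      refine ⟨⟨⟨fun _ => (H.1.ball 0).root, fun _ => (G.1.ball 0).root, fun a => (key _ a).symm,
        fun a => (key _ a).symm⟩, ?_⟩, rfl⟩
      intro a b
      rw [key _ a, key _ b]
      simp

theorem dloc_bddBelow (x y : GStar) :
    BddBelow ((fun r : ℕ => (1 / 2 : ℝ) ^ r) '' {r | BallsIso r x y}) :=
  ⟨0, by rintro _ ⟨r, -, rfl⟩; positivity⟩

theorem dloc_nonempty (x y : GStar) :
    ((fun r : ℕ => (1 / 2 : ℝ) ^ r) '' {r | BallsIso r x y}).Nonempty :=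
  ⟨_, 0, BallsIso.zero x y, rfl⟩

theorem dloc_nonneg (x y : GStar) : 0 ≤ dloc x y :=
  le_csInf (dloc_nonempty x y) (by rintro _ ⟨r, -, rfl⟩; positivity)

theorem dloc_self (x : GStar) : dloc x x = 0 := by
  refine le_antisymm (le_of_forall_pos_lt_add fun ε hε => ?_) (dloc_nonneg x x)
  obtain ⟨r, hr⟩ := exists_pow_lt_of_lt_one hε (by norm_num : (1 / 2 : ℝ) < 1)
  have := csInf_le (dloc_bddBelow x x) ⟨r, BallsIso.refl r x, rfl⟩
  rw [zero_add]
  exact this.trans_lt hr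

theorem dloc_comm (x y : GStar) : dloc x y = dloc y x := by
  have h : {r | BallsIso r x y} = {r | BallsIso r y x} :=
    Set.ext fun r => ⟨fun h => h.symm, fun h => h.symm⟩
  rw [dloc, dloc, h]

theorem dloc_triangle (x y z : GStar) : dloc x z ≤ dloc x y + dloc y z := by
  by_contra! h
  have hxy : dloc x y < dloc x z := by linarith [dloc_nonneg y z]
  have hyz : dloc y z < dloc x z := by linarith [dloc_nonneg x y]
  obtain ⟨_, ⟨r, hr, rfl⟩, hr'⟩ := exists_lt_of_csInf_lt (dloc_nonempty x y) hxy
  obtain ⟨_, ⟨s, hs, rfl⟩, hs'⟩ := exists_lt_of_csInf_lt (dloc_nonempty y z) hyz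
  have hm : BallsIso (min r s) x z :=
    (BallsIso.mono (min_le_left r s) hr).trans (BallsIso.mono (min_le_right r s) hs)
  have hle : dloc x z ≤ (1 / 2 : ℝ) ^ (min r s) :=
    csInf_le (dloc_bddBelow x z) ⟨min r s, hm, rfl⟩
  rcases min_choice r s with e | e
  · rw [e] at hle; exact absurd hr' (not_lt.2 hle)
  · rw [e] at hle; exact absurd hs' (not_lt.2 hle)

noncomputable instance : PseudoMetricSpace GStar where
  dist := dloc
  dist_self := dloc_self
  dist_comm := dloc_comm
  dist_triangle := dloc_triangle

/-- The Borel σ-algebra of the local distance. -/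
noncomputable instance : MeasurableSpace GStar := borel GStar

instance : BorelSpace GStar := ⟨rfl⟩

end GStar

/-! ### Convergence in probability -/

/-- `X n → c` in probability, where `X n` is a random variable on `(Ω n, P n)`. -/
def TendstoInProb {Ω : ℕ → Type u} [∀ n, MeasurableSpace (Ω n)] (P : ∀ n, Measure (Ω n))
    (X : ∀ n, Ω n → ℝ) (c : ℝ) : Prop :=
  ∀ ε : ℝ, 0 < ε → Tendsto (fun n => P n {ω | ε < |X n ω - c|}) atTop (𝓝 0)

/-- `p_r(G, H)`: the fraction of vertices `x` of the finite graph `G` with `B_r(G, x) ≅ H`. -/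
noncomputable def ballFraction {V : Type u} [Fintype V] (r : ℕ) (G : SimpleGraph V)
    (H : RootedGraph.{0}) : ℝ :=
  ({x : V | ((RootedGraph.mk V G x).ball r).Iso H}.ncard : ℝ) / (Fintype.card V : ℝ)

/-- Local weak convergence in probability of the random finite graphs `G n` to a random element of
`𝒢_*` with law `μ`: for all `r` and all finite rooted connected graphs `H`, the fraction
`p_r(G n, H)` converges in probability to the probability that `B_r ≅ H` under `μ`. -/
def LocallyConvergesInProb {Ω : ℕ → Type u} [∀ n, MeasurableSpace (Ω n)]
    (P : ∀ n, Measure (Ω n)) {V : ℕ → Type v} [∀ n, Fintype (V n)]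
    (G : ∀ n, Ω n → SimpleGraph (V n)) (μ : Measure GStar) : Prop :=
  ∀ (r : ℕ) (H : RootedGraph.{0}), Finite H.V → H.graph.Connected →
    TendstoInProb P (fun n ω => ballFraction r (G n ω) H) (μ.real {x | x.BallIso r H})

/-! ### Degree moments and the assortativity coefficient of a finite graph -/

/-- The `k`-th moment of the degree of a uniformly random vertex of the finite graph `G`. -/
noncomputable def degreeMoment {V : Type u} [Fintype V] (G : SimpleGraph V) (k : ℕ) : ℝ :=
  (∑ x : V, (vertexDegree G x : ℝ) ^ k) / (Fintype.card V : ℝ)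

/-- `(2 e(G))⁻¹ ∑ f(u, v)`, the sum being over the `2 e(G)` ordered pairs `(u, v)` of adjacent
vertices of `G`. -/
noncomputable def adjacentAverage {V : Type u} [Fintype V] (G : SimpleGraph V)
    (f : V → V → ℝ) : ℝ :=
  open scoped Classical in
  (2 * (G.edgeSet.ncard : ℝ))⁻¹ * ∑ p : V × V with G.Adj p.1 p.2, f p.1 p.2

/-- The assortativity coefficient `r(G)`: with averages over all ordered pairs `(u, v)` of adjacent
vertices, `g`, `b` and `b'` are the averages of `d(u) d(v)`, `d(u)` and `d(u) ^ 2`, and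
`r(G) = (g - b ^ 2) / (b' - b ^ 2)`; it is `0` if `G` has no edges or `b' - b ^ 2 = 0`. -/
noncomputable def assortativity {V : Type u} [Fintype V] (G : SimpleGraph V) : ℝ :=
  let g := adjacentAverage G fun x y => (vertexDegree G x : ℝ) * (vertexDegree G y : ℝ)
  let b := adjacentAverage G fun x _ => (vertexDegree G x : ℝ)
  let b' := adjacentAverage G fun x _ => (vertexDegree G x : ℝ) ^ 2
  open scoped Classical in
  if G.edgeSet.ncard = 0 ∨ b' - b ^ 2 = 0 then 0 else (g - b ^ 2) / (b' - b ^ 2)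

/-! ### Finite balls and an enumeration of the finite connected rooted graphs -/

namespace RootedGraph

/-! Counting vertex by vertex, the sum of `d(u) d(v)` over ordered adjacent pairs is the sum over
`x` of hom'(P₄', G, x). Hence r(G) = (m₁ h - m₂²) / (m₁ m₃ - m₂²), where m_k is the mean of d^k and
h the mean of hom' over a uniform vertex (`assortativity_eq`). All four means average a function of
the ball of radius 2, so it suffices that each converges in probability to its counterpart for G*.
The quotient is continuous at the limit because the limiting denominator is nonzero. Convergence of
expectations follows from |r(G)| ≤ 1, since r(G) is a correlation coefficient
(`abs_assortativity_le_one`).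

Finite connected rooted graphs have countably many isomorphism types, so a function of the 2-ball
becomes a function f on ℕ evaluated at the index of the type. Cutting f at an index M leaves a head
that involves finitely many types, whose average converges in L¹ directly by local convergence
(`tendsto_codeAverage_headPart`). What remains is that the tails have small mean, uniformly in large
n (`tendsto_codeAverage`). For d³ this follows from convergence of the third moment
(`eventually_integral_tailPart_le`), and the lower moments are dominated by d³.

The path count is the delicate case, because hom'(x) = d(x) ∑ d(y) over neighbours y is not bounded
by a function of d(x). Symmetry of the adjacency relation helps: a term in d(y)² can be charged to y
instead of x. For x in the tail, a neighbour y with small index has bounded degree, and the term is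
charged to x; if y has large index, d(x) d(y) ≤ d(x)² + d(y)², and the second term is charged to the
tail of d³ at y (`codeAverage_tailPart_enumHom_le`). The same symmetry bounds the mean of hom' by
that of d³ (`codeAverage_enumHom_le`), which passes to the limit and gives integrability for G*. -/

theorem finite_ball {G : RootedGraph.{u}} (h : G.IsLocallyFinite) (r : ℕ) :
    Finite (G.ball r).V := by
  change Finite {w : G.V | G.graph.edist G.root w ≤ (r : ℕ∞)}
  rw [Set.finite_coe_iff]
  induction r with
  | zero =>
    refine (Set.finite_singleton G.root).subset fun w hw => ?_
    simpa using hw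
  | succ r ih =>
    refine ((ih.biUnion fun y _ => h y).union ih).subset fun w hw => ?_
    obtain ⟨p, hp⟩ := SimpleGraph.exists_walk_of_edist_ne_top
      (ne_top_of_le_ne_top (ENat.natCast_ne_top (r + 1)) hw)
    have hw' : p.length ≤ r + 1 := by
      have : (p.length : ℕ∞) ≤ ((r + 1 : ℕ) : ℕ∞) := hp ▸ hw
      exact_mod_cast this
    -- The walk is reversed so that case analysis removes the edge at `w`, leaving a neighbour of
    -- `w` within distance `r` of the root.
    obtain ⟨q, hq⟩ : ∃ q : G.graph.Walk w G.root, q.length ≤ r + 1 :=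
      ⟨p.reverse, by simpa using hw'⟩
    cases q with
    | nil => right; simp
    | cons hadj q =>
      rename_i y
      left
      simp only [Set.mem_iUnion]
      refine ⟨y, ?_, hadj.symm⟩
      change G.graph.edist G.root y ≤ (r : ℕ∞)
      refine (SimpleGraph.edist_le q.reverse).trans ?_
      rw [SimpleGraph.Walk.length_reverse]
      rw [SimpleGraph.Walk.length_cons] at hq
      exact_mod_cast Nat.le_of_succ_le_succ hq

theorem connected_ball (G : RootedGraph.{u}) (r : ℕ) : (G.ball r).graph.Connected := by
  have key : ∀ x, (G.ball r).graph.Reachable (G.ball r).root x := fun x => by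
    rw [← SimpleGraph.edist_ne_top_iff_reachable, edist_ball]
    exact ne_top_of_le_ne_top (ENat.natCast_ne_top r) x.2
  have : Nonempty (G.ball r).V := ⟨(G.ball r).root⟩
  exact ⟨fun x y => (key x).symm.trans (key y)⟩

theorem vertexDegree_ball (G : RootedGraph.{u}) {r : ℕ} (hr : 1 ≤ r) :
    vertexDegree (G.ball r).graph (G.ball r).root = vertexDegree G.graph G.root := by
  have hr' : ((1 : ℕ) : ℕ∞) ≤ (r : ℕ∞) := by exact_mod_cast hr
  refine Nat.card_congr ⟨fun y => ⟨y.1.1, y.2⟩, fun y => ⟨⟨y.1, ?_⟩, y.2⟩, fun _ => rfl,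
    fun _ => rfl⟩
  have hadj : G.graph.Adj G.root y.1 := y.2
  refine (SimpleGraph.edist_le hadj.toWalk).trans ?_
  simpa using hr'

/-- Homomorphisms do not increase distances, so the whole image of `K` stays in the ball, and the
ball is an induced subgraph. -/
theorem rootedHomCount_ball {W : Type w} (K : SimpleGraph W) (a : W) (G : RootedGraph.{u}) {r : ℕ}
    (hK : ∀ b, K.edist a b ≤ (r : ℕ∞)) :
    rootedHomCount K a (G.ball r).graph (G.ball r).root = rootedHomCount K a G.graph G.root := by
  refine Nat.card_congr ⟨fun f => ⟨(SimpleGraph.Embedding.induce _).toHom.comp f.1, ?_⟩,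
    fun f => ⟨⟨fun b => ⟨f.1 b, ?_⟩, fun {b c} h => f.1.map_rel h⟩, ?_⟩, fun _ => rfl, fun _ => rfl⟩
  · exact congrArg Subtype.val f.2
  · have := edist_map_le f.1 a b
    rw [f.2] at this
    exact this.trans (hK b)
  · exact Subtype.ext f.2

/-- The finite connected rooted graphs on the vertex sets `Fin k`. -/
def FinModel : Type :=
  {p : Σ k : ℕ, SimpleGraph (Fin k) × Fin k // p.2.1.Connected}

instance : Countable FinModel := by unfold FinModel; infer_instance

instance : Nonempty FinModel :=
  ⟨⟨⟨1, ⊥, 0⟩, ⟨fun x y => by rw [Subsingleton.elim x y]⟩⟩⟩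

/-- An enumeration of the finite connected rooted graphs, up to isomorphism. -/
noncomputable def enum (i : ℕ) : RootedGraph.{0} :=
  let p := (exists_surjective_nat FinModel).choose i
  ⟨Fin p.1.1, p.1.2.1, p.1.2.2⟩

theorem finite_enum (i : ℕ) : Finite (enum i).V :=
  inferInstanceAs (Finite (Fin _))

theorem connected_enum (i : ℕ) : (enum i).graph.Connected :=
  ((exists_surjective_nat FinModel).choose i).2

theorem exists_iso_enum {G : RootedGraph.{u}} (hf : Finite G.V) (hc : G.graph.Connected) :
    ∃ i, G.Iso (enum i) := by
  obtain ⟨k, ⟨e⟩⟩ := Finite.exists_equiv_fin G.V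
  let φ : G.graph ≃g G.graph.map e.toEmbedding := SimpleGraph.Iso.map e G.graph
  obtain ⟨i, hi⟩ := (exists_surjective_nat FinModel).choose_spec
    ⟨⟨k, G.graph.map e.toEmbedding, e G.root⟩, φ.connected_iff.1 hc⟩
  refine ⟨i, ?_⟩
  unfold enum
  rw [hi]
  exact ⟨φ, rfl⟩

/-- The least index of a rooted graph in the enumeration. -/
noncomputable def code (G : RootedGraph.{u}) : ℕ := sInf {i | G.Iso (enum i)}

theorem iso_enum_code {G : RootedGraph.{u}} (hf : Finite G.V) (hc : G.graph.Connected) :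
    G.Iso (enum G.code) :=
  Nat.sInf_mem (s := {i | G.Iso (enum i)}) (exists_iso_enum hf hc)

theorem Iso.code_eq {G : RootedGraph.{u}} {H : RootedGraph.{v}} (h : G.Iso H) :
    G.code = H.code := by
  unfold code
  congr 1
  ext i
  exact ⟨fun k => h.symm.trans k, fun k => h.trans k⟩

/-- The enumeration repeats isomorphism types, and only the least index of a type is ever a code.
The second conjunct does not involve `G`, so each level set of the code is either a full isomorphism
class or empty. -/
theorem code_eq_iff {G : RootedGraph.{u}} (hf : Finite G.V) (hc : G.graph.Connected) (i : ℕ) :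
    G.code = i ↔ G.Iso (enum i) ∧ (enum i).code = i := by
  constructor
  · rintro rfl
    have h := iso_enum_code hf hc
    exact ⟨h, h.code_eq.symm⟩
  · rintro ⟨h, h'⟩
    rw [h.code_eq, h']

/-- The degree of the root of the `i`-th rooted graph. -/
noncomputable def enumDegree (i : ℕ) : ℕ := vertexDegree (enum i).graph (enum i).root

/-- The number of homomorphisms from `P₄`, rooted at an internal vertex, to the `i`-th rooted
graph. -/
noncomputable def enumHom (i : ℕ) : ℕ :=
  rootedHomCount (SimpleGraph.pathGraph 4) 1 (enum i).graph (enum i).root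

/-- An internal vertex of P₄ has eccentricity 2, which is why balls of radius 2 are used throughout.
-/
theorem edist_pathGraph_le (b : Fin 4) : (SimpleGraph.pathGraph 4).edist 1 b ≤ ((2 : ℕ) : ℕ∞) := by
  have h10 : (SimpleGraph.pathGraph 4).Adj 1 0 := by simp [SimpleGraph.pathGraph_adj]
  have h12 : (SimpleGraph.pathGraph 4).Adj 1 2 := by simp [SimpleGraph.pathGraph_adj]
  have h23 : (SimpleGraph.pathGraph 4).Adj 2 3 := by simp [SimpleGraph.pathGraph_adj]
  fin_cases b
  · exact (SimpleGraph.edist_le h10.toWalk).trans (by simp)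
  · simp
  · exact (SimpleGraph.edist_le h12.toWalk).trans (by simp)
  · exact (SimpleGraph.edist_le (.cons h12 h23.toWalk)).trans (by simp)

theorem enumDegree_code_ball {G : RootedGraph.{u}} (h : G.IsLocallyFinite) :
    enumDegree (G.ball 2).code = vertexDegree G.graph G.root := by
  rw [← G.vertexDegree_ball one_le_two]
  exact (iso_enum_code (finite_ball h 2) (G.connected_ball 2)).symm.degree_eq

theorem enumHom_code_ball {G : RootedGraph.{u}} (h : G.IsLocallyFinite) :
    enumHom (G.ball 2).code = rootedHomCount (SimpleGraph.pathGraph 4) 1 G.graph G.root := by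
  rw [← rootedHomCount_ball _ _ G edist_pathGraph_le]
  exact (iso_enum_code (finite_ball h 2) (G.connected_ball 2)).symm.rootedHomCount_eq _ _

end RootedGraph

namespace GStar

/-- The index of the ball of radius two. -/
noncomputable def code (x : GStar) : ℕ :=
  Quotient.lift (fun G : LocalGraph => (G.1.ball 2).code)
    (fun _ _ (h : RootedGraph.Iso _ _) => (h.ball 2).code_eq) x

theorem enumDegree_code (x : GStar) : RootedGraph.enumDegree x.code = x.degree := by
  induction x using Quotient.inductionOn with
  | h G => exact RootedGraph.enumDegree_code_ball G.2.2

theorem enumHom_code (x : GStar) :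
    RootedGraph.enumHom x.code = x.homCount (SimpleGraph.pathGraph 4) 1 := by
  induction x using Quotient.inductionOn with
  | h G => exact RootedGraph.enumHom_code_ball G.2.2

theorem code_eq_iff (x : GStar) (i : ℕ) :
    x.code = i ↔ x.BallIso 2 (RootedGraph.enum i) ∧ (RootedGraph.enum i).code = i := by
  induction x using Quotient.inductionOn with
  | h G =>
    exact RootedGraph.code_eq_iff (RootedGraph.finite_ball G.2.2 2) (G.1.connected_ball 2) i

theorem BallsIso.code_eq {x y : GStar} (h : BallsIso 2 x y) : x.code = y.code := by
  induction x using Quotient.inductionOn with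
  | h G =>
    induction y using Quotient.inductionOn with
    | h H => exact RootedGraph.Iso.code_eq h

/-- Level sets are open: local distance below (1/2)² forces isomorphic balls of some radius
exceeding 2, hence equal codes. -/
theorem measurable_code : Measurable code := by
  refine measurable_to_countable' fun i => IsOpen.measurableSet ?_
  rw [Metric.isOpen_iff]
  refine fun x hx => ⟨(1 / 2) ^ 2, by positivity, fun y hy => ?_⟩
  obtain ⟨_, ⟨r, hr, rfl⟩, hr'⟩ := exists_lt_of_csInf_lt (dloc_nonempty y x) hy
  have h2 : 2 < r := (pow_lt_pow_iff_right_of_lt_one₀ (by norm_num) (by norm_num)).1 hr'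
  exact (BallsIso.mono h2.le hr).code_eq.trans hx

end GStar

/-! ### Averages over the vertices of a finite graph -/

section Finite

variable {V : Type u} [Fintype V]

/-- The index of the ball of radius two around a vertex. -/
noncomputable def vertexCode (G : SimpleGraph V) (x : V) : ℕ :=
  ((RootedGraph.mk V G x).ball 2).code

theorem enumDegree_vertexCode (G : SimpleGraph V) (x : V) :
    RootedGraph.enumDegree (vertexCode G x) = vertexDegree G x :=
  RootedGraph.enumDegree_code_ball (G := ⟨V, G, x⟩) fun _ => Set.toFinite _

theorem enumHom_vertexCode (G : SimpleGraph V) (x : V) :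
    RootedGraph.enumHom (vertexCode G x) = rootedHomCount (SimpleGraph.pathGraph 4) 1 G x :=
  RootedGraph.enumHom_code_ball (G := ⟨V, G, x⟩) fun _ => Set.toFinite _

/-- The average over the vertices `x` of `f`, evaluated at the index of the ball of radius two
around `x`. -/
noncomputable def codeAverage (G : SimpleGraph V) (f : ℕ → ℝ) : ℝ :=
  (∑ x : V, f (vertexCode G x)) / (Fintype.card V : ℝ)

theorem vertexCode_eq_iff (G : SimpleGraph V) (x : V) (i : ℕ) :
    vertexCode G x = i ↔ ((RootedGraph.mk V G x).ball 2).Iso (RootedGraph.enum i) ∧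
      (RootedGraph.enum i).code = i :=
  RootedGraph.code_eq_iff (RootedGraph.finite_ball (fun _ => Set.toFinite _) 2)
    (RootedGraph.connected_ball _ 2) i

theorem vertexDegree_eq_sum (G : SimpleGraph V) (x : V) :
    open scoped Classical in vertexDegree G x = ∑ y : V, if G.Adj x y then 1 else 0 := by
  classical
  rw [vertexDegree, ← Nat.card_coe_set_eq, Nat.card_eq_fintype_card, Fintype.card_subtype,
    Finset.card_filter]
  rfl

/-- With 1 sent to `x`, the end 0 goes to any neighbour of `x`, independently of 2 going to a
neighbour `y` and 3 to a neighbour of `y`. -/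
theorem rootedHomCount_pathGraph_four (G : SimpleGraph V) (x : V) :
    open scoped Classical in rootedHomCount (SimpleGraph.pathGraph 4) 1 G x =
      ∑ y : V, if G.Adj x y then vertexDegree G x * vertexDegree G y else 0 := by
  classical
  have h (φ : {φ : SimpleGraph.pathGraph 4 →g G // φ 1 = x}) (i : Fin 4)
      (hi : (SimpleGraph.pathGraph 4).Adj 1 i) : G.Adj x (φ.1 i) := by
    have := φ.1.map_rel hi
    rwa [φ.2] at this
  have e : {φ : SimpleGraph.pathGraph 4 →g G // φ 1 = x} ≃
      G.neighborSet x × Σ y : G.neighborSet x, G.neighborSet (y : V) :=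
    { toFun := fun φ =>
        ⟨⟨φ.1 0, h φ 0 (by simp [SimpleGraph.pathGraph_adj])⟩,
        ⟨⟨φ.1 2, h φ 2 (by simp [SimpleGraph.pathGraph_adj])⟩,
        ⟨φ.1 3, φ.1.map_rel (by simp [SimpleGraph.pathGraph_adj])⟩⟩⟩
      invFun := fun q => ⟨⟨![q.1, x, q.2.1, q.2.2], by
        have h1 : G.Adj x q.1 := q.1.2
        have h2 : G.Adj x q.2.1 := q.2.1.2
        have h3 : G.Adj q.2.1 q.2.2 := q.2.2.2
        intro a b hab
        rw [SimpleGraph.pathGraph_adj] at hab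
        fin_cases a <;> fin_cases b <;> simp at hab <;>
          first
          | exact h1 | exact h1.symm | exact h2 | exact h2.symm | exact h3 | exact h3.symm⟩, rfl⟩
      left_inv := fun φ => by
        refine Subtype.ext (RelHom.ext fun a => ?_)
        fin_cases a
        · rfl
        · exact φ.2.symm
        · rfl
        · rfl
      right_inv := fun q => rfl }
  have hsum : ∑ y : G.neighborSet x, vertexDegree G (y : V) =
      ∑ y : V, if G.Adj x y then vertexDegree G y else 0 := by
    rw [← Finset.sum_filter]
    exact (Finset.sum_subtype _ (by simp) _).symm
  rw [rootedHomCount, Nat.card_congr e, Nat.card_prod, Nat.card_sigma]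
  change vertexDegree G x * ∑ y : G.neighborSet x, vertexDegree G (y : V) = _
  rw [hsum, Finset.mul_sum]
  exact Finset.sum_congr rfl fun y _ => by split_ifs <;> simp

end Finite

/-- The indicator of adjacency. -/
noncomputable def adjWeight {V : Type u} (G : SimpleGraph V) (x y : V) : ℝ :=
  open scoped Classical in if G.Adj x y then 1 else 0

theorem adjWeight_nonneg {V : Type u} (G : SimpleGraph V) (x y : V) : 0 ≤ adjWeight G x y := by
  unfold adjWeight; split_ifs <;> norm_num

theorem adjWeight_comm {V : Type u} (G : SimpleGraph V) (x y : V) :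
    adjWeight G x y = adjWeight G y x := by
  classical
  exact if_congr (G.adj_comm x y) rfl rfl

section Finite

variable {V : Type u} [Fintype V]

theorem sum_adjWeight (G : SimpleGraph V) (x : V) :
    ∑ y, adjWeight G x y = (vertexDegree G x : ℝ) := by
  rw [vertexDegree_eq_sum]
  push_cast
  rfl

theorem sum_adjWeight_left (G : SimpleGraph V) (f : V → ℝ) :
    ∑ x, ∑ y, adjWeight G x y * f x = ∑ x, (vertexDegree G x : ℝ) * f x := by
  simp_rw [← Finset.sum_mul, sum_adjWeight]

/-- Adjacency is symmetric, so a weight on the second end of an ordered edge may be moved to the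
first. This is the charging device behind both bounds on path counts. -/
theorem sum_adjWeight_right (G : SimpleGraph V) (f : V → ℝ) :
    ∑ x, ∑ y, adjWeight G x y * f y = ∑ x, (vertexDegree G x : ℝ) * f x := by
  rw [Finset.sum_comm, ← sum_adjWeight_left]
  simp_rw [adjWeight_comm G]

theorem enumHom_vertexCode_eq_sum (G : SimpleGraph V) (x : V) :
    (RootedGraph.enumHom (vertexCode G x) : ℝ) =
      ∑ y, adjWeight G x y * ((vertexDegree G x : ℝ) * (vertexDegree G y : ℝ)) := by
  rw [enumHom_vertexCode, rootedHomCount_pathGraph_four]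
  push_cast
  exact Finset.sum_congr rfl fun y _ => by simp only [adjWeight]; split_ifs <;> simp

theorem degreeMoment_eq_codeAverage (G : SimpleGraph V) (k : ℕ) :
    degreeMoment G k = codeAverage G fun i => (RootedGraph.enumDegree i : ℝ) ^ k := by
  simp only [degreeMoment, codeAverage, enumDegree_vertexCode]

theorem codeAverage_mono (G : SimpleGraph V) {f g : ℕ → ℝ} (h : ∀ i, f i ≤ g i) :
    codeAverage G f ≤ codeAverage G g := by
  unfold codeAverage
  gcongr
  exact h _

theorem codeAverage_add (G : SimpleGraph V) (f g : ℕ → ℝ) :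
    codeAverage G (fun i => f i + g i) = codeAverage G f + codeAverage G g := by
  simp only [codeAverage, Finset.sum_add_distrib, add_div]

theorem two_mul_ncard_edgeSet (G : SimpleGraph V) :
    2 * (G.edgeSet.ncard : ℝ) = ∑ x, (vertexDegree G x : ℝ) := by
  classical
  have h := G.sum_degrees_eq_twice_card_edges
  have he : G.edgeFinset.card = G.edgeSet.ncard := by
    rw [← G.coe_edgeFinset, Set.ncard_coe_finset]
  have hd : ∀ x, G.degree x = vertexDegree G x := fun x => by
    rw [vertexDegree, ← SimpleGraph.card_neighborSet_eq_degree, ← Nat.card_coe_set_eq,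
      Nat.card_eq_fintype_card]
  rw [he] at h
  simp_rw [hd] at h
  exact_mod_cast h.symm

theorem adjacentAverage_eq (G : SimpleGraph V) (f : V → V → ℝ) :
    adjacentAverage G f =
      (∑ x, (vertexDegree G x : ℝ))⁻¹ * ∑ x, ∑ y, adjWeight G x y * f x y := by
  classical
  rw [adjacentAverage, two_mul_ncard_edgeSet,
    ← Fintype.sum_prod_type' (fun x y => adjWeight G x y * f x y),
    Finset.sum_filter]
  congr 1
  refine Finset.sum_congr ?_ fun p _ => ?_
  · ext; simp
  · simp only [adjWeight]
    split_ifs <;> simp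

theorem edgeSet_ncard_eq_zero_iff (G : SimpleGraph V) :
    G.edgeSet.ncard = 0 ↔ ∑ x, (vertexDegree G x : ℝ) = 0 := by
  rw [← two_mul_ncard_edgeSet]
  simp

/-! ### The assortativity coefficient: formula by vertex averages, and boundedness -/

theorem assortativity_eq [Nonempty V] (G : SimpleGraph V) :
    assortativity G =
      (degreeMoment G 1 * codeAverage G (fun i => (RootedGraph.enumHom i : ℝ))
        - degreeMoment G 2 ^ 2) /
      (degreeMoment G 1 * degreeMoment G 3 - degreeMoment G 2 ^ 2) := by
  have hN : (Fintype.card V : ℝ) ≠ 0 := by exact_mod_cast Fintype.card_ne_zero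
  simp only [assortativity, adjacentAverage_eq, edgeSet_ncard_eq_zero_iff, sum_adjWeight_left G,
    degreeMoment, codeAverage,
    enumHom_vertexCode_eq_sum, pow_one]
  have h2 : ∑ x, (vertexDegree G x : ℝ) * (vertexDegree G x : ℝ) =
      ∑ x, (vertexDegree G x : ℝ) ^ 2 := Finset.sum_congr rfl fun x _ => by ring
  have h3 : ∑ x, (vertexDegree G x : ℝ) * (vertexDegree G x : ℝ) ^ 2 =
      ∑ x, (vertexDegree G x : ℝ) ^ 3 := Finset.sum_congr rfl fun x _ => by ring
  rw [h2, h3]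
  set N : ℝ := (Fintype.card V : ℝ)
  -- Without edges the right-hand side is 0 / 0, which is 0 by convention and so agrees with the
  -- default value of r(G).
  have h0 : ∑ x, (vertexDegree G x : ℝ) = 0 → ∑ x, (vertexDegree G x : ℝ) ^ 2 = 0 := by
    intro h
    rw [Finset.sum_eq_zero_iff_of_nonneg fun x _ => by positivity] at h
    exact Finset.sum_eq_zero fun x hx => by rw [h x hx]; norm_num
  generalize ∑ x, (vertexDegree G x : ℝ) = s1 at *
  generalize ∑ x, (vertexDegree G x : ℝ) ^ 2 = s2 at *
  generalize ∑ x, (vertexDegree G x : ℝ) ^ 3 = s3 at *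
  generalize ∑ x, ∑ y, adjWeight G x y * ((vertexDegree G x : ℝ) * (vertexDegree G y : ℝ)) = t at *
  by_cases hs : s1 = 0
  · rw [if_pos (Or.inl hs), hs, h0 hs]
    simp
  -- Edge averages are normalised by `s1` and vertex averages by `N`; numerator and denominator both
  -- acquire the factor (s1 / N)², which cancels.
  · have key : ∀ z, s1 / N * (z / N) - (s2 / N) ^ 2 =
        (s1 / N) ^ 2 * (s1⁻¹ * z - (s1⁻¹ * s2) ^ 2) := fun z => by field_simp
    rw [key, key, mul_div_mul_left _ _ (pow_ne_zero 2 (div_ne_zero hs hN))]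
    split_ifs with h
    · rw [h.resolve_left hs, div_zero]
    · rfl

/-- For a uniform ordered edge, with end degrees X and Y, r(G) is the correlation of X and Y. They
have the same law by symmetry, so E(X - Y)² ≥ 0 and E(X + Y - 2b)² ≥ 0 give the upper and lower
bounds on the covariance. In the proof `S` is this expectation. -/
theorem abs_assortativity_le_one (G : SimpleGraph V) : |assortativity G| ≤ 1 := by
  simp only [assortativity, adjacentAverage_eq, edgeSet_ncard_eq_zero_iff]
  split_ifs with h
  · simp
  push Not at h
  obtain ⟨hs, -⟩ := h
  set d : V → ℝ := fun x => (vertexDegree G x : ℝ)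
  set s : ℝ := ∑ x, (vertexDegree G x : ℝ) with hs_def
  have hs0 : 0 ≤ s := Finset.sum_nonneg fun x _ => by positivity
  set S : (V → V → ℝ) → ℝ := fun f => s⁻¹ * ∑ x, ∑ y, adjWeight G x y * f x y with hS
  have hadd : ∀ f g, S (fun x y => f x y + g x y) = S f + S g := fun f g => by
    simp only [hS, mul_add, Finset.sum_add_distrib]
  have hmul : ∀ (c : ℝ) f, S (fun x y => c * f x y) = c * S f := fun c f => by
    simp only [hS, mul_left_comm _ c, ← Finset.mul_sum]
  have hone : S (fun _ _ => 1) = 1 := by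
    simp only [hS, mul_one, sum_adjWeight]
    exact inv_mul_cancel₀ hs
  have hpos : ∀ f : V → V → ℝ, (∀ x y, 0 ≤ f x y) → 0 ≤ S f := fun f hf =>
    mul_nonneg (inv_nonneg.2 hs0) (Finset.sum_nonneg fun x _ => Finset.sum_nonneg fun y _ =>
      mul_nonneg (adjWeight_nonneg G x y) (hf x y))
  have hswap : ∀ f : V → ℝ, S (fun _ y => f y) = S (fun x _ => f x) := fun f => by
    simp only [hS, sum_adjWeight_left, sum_adjWeight_right]
  change |(S (fun x y => d x * d y) - S (fun x _ => d x) ^ 2) /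
    (S (fun x _ => d x ^ 2) - S (fun x _ => d x) ^ 2)| ≤ 1
  set g := S (fun x y => d x * d y) with hg
  set b := S (fun x _ => d x) with hb
  set b' := S (fun x _ => d x ^ 2) with hb'
  have h1 : 0 ≤ 2 * b' + (-2) * g := by
    have := hpos (fun x y => (d x - d y) ^ 2) fun x y => sq_nonneg _
    have e : (fun x y => (d x - d y) ^ 2) =
        fun x y => (d x ^ 2 + (fun _ y => d y ^ 2) x y) + (-2) * (d x * d y) := by
      ext x y; ring
    rw [e, hadd, hadd, hmul, hswap fun y => d y ^ 2] at this
    linarith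
  have h2 : 0 ≤ 2 * b' + 2 * g - 4 * b ^ 2 := by
    have := hpos (fun x y => (d x + d y - 2 * b) ^ 2) fun x y => sq_nonneg _
    have e : (fun x y => (d x + d y - 2 * b) ^ 2) =
        fun x y => (((d x ^ 2 + (fun _ y => d y ^ 2) x y) + 2 * (d x * d y)) +
          (-4 * b) * (d x + (fun _ y => d y) x y)) + (4 * b ^ 2) * 1 := by
      ext x y; ring
    rw [e, hadd, hadd, hadd, hadd, hmul, hmul, hmul, hadd, hswap fun y => d y ^ 2, hswap, hone]
      at this
    rw [← hg, ← hb, ← hb'] at this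
    linarith
  rw [abs_div]
  refine div_le_one_of_le₀ ?_ (abs_nonneg _)
  refine (abs_le.2 ⟨?_, ?_⟩).trans (le_abs_self _) <;> linarith

/-! ### Truncation by index, and bounds on path counts -/

/-- The part of a function on `ℕ` on the arguments at least `M`. -/
noncomputable def tailPart (M : ℕ) (f : ℕ → ℝ) (i : ℕ) : ℝ := if i < M then 0 else f i

/-- The part of a function on `ℕ` on the arguments less than `M`. -/
noncomputable def headPart (M : ℕ) (f : ℕ → ℝ) (i : ℕ) : ℝ := if i < M then f i else 0

theorem headPart_add_tailPart (M : ℕ) (f : ℕ → ℝ) (i : ℕ) :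
    headPart M f i + tailPart M f i = f i := by
  unfold headPart tailPart; split_ifs <;> simp

/-- Grouping vertices by index turns a truncated average into a finite linear combination of ball
frequencies, the quantities controlled by local convergence. -/
theorem codeAverage_headPart (G : SimpleGraph V) (M : ℕ) (f : ℕ → ℝ) :
    codeAverage G (headPart M f) = ∑ i ∈ Finset.range M,
      f i * (({x : V | vertexCode G x = i}.ncard : ℝ) / (Fintype.card V : ℝ)) := by
  classical
  have h : ∀ j, headPart M f j = ∑ i ∈ Finset.range M, if j = i then f i else 0 := fun j => by
    simp [headPart]
  simp only [codeAverage, h]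
  rw [Finset.sum_comm, Finset.sum_div]
  refine Finset.sum_congr rfl fun i _ => ?_
  rw [← Finset.sum_filter, Finset.sum_const, nsmul_eq_mul, mul_comm, mul_div_assoc]
  congr 3
  rw [← Nat.card_coe_set_eq, Nat.card_eq_fintype_card, Fintype.card_subtype]
  rfl

/-- On each edge d(x) d(y) ≤ (d(x)² + d(y)²) / 2, and by symmetry either square sums to ∑ d³ over
ordered edges. The bound holds on average only, not vertex by vertex. -/
theorem codeAverage_enumHom_le (G : SimpleGraph V) :
    codeAverage G (fun i => (RootedGraph.enumHom i : ℝ)) ≤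
      codeAverage G (fun i => (RootedGraph.enumDegree i : ℝ) ^ 3) := by
  unfold codeAverage
  gcongr ?_ / _
  simp only [enumHom_vertexCode_eq_sum, enumDegree_vertexCode]
  have h1 := sum_adjWeight_left G fun x => (vertexDegree G x : ℝ) ^ 2
  have h2 := sum_adjWeight_right G fun x => (vertexDegree G x : ℝ) ^ 2
  have h3 : ∑ x, (vertexDegree G x : ℝ) ^ 3 =
      (∑ x, ∑ y, adjWeight G x y * (vertexDegree G x : ℝ) ^ 2 +
        ∑ x, ∑ y, adjWeight G x y * (vertexDegree G y : ℝ) ^ 2) / 2 := by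
    rw [h1, h2, add_self_div_two]
    exact Finset.sum_congr rfl fun x _ => by ring
  rw [h3, ← Finset.sum_add_distrib, Finset.sum_div]
  refine Finset.sum_le_sum fun x _ => ?_
  rw [← Finset.sum_add_distrib, Finset.sum_div]
  refine Finset.sum_le_sum fun y _ => ?_
  rw [← mul_add, mul_div_assoc]
  refine mul_le_mul_of_nonneg_left ?_ (adjWeight_nonneg G x y)
  nlinarith [sq_nonneg ((vertexDegree G x : ℝ) - vertexDegree G y)]

/-- The key uniform integrability estimate: the contribution of the vertices with large index to
the number of paths is controlled by their contribution to the third moment of the degree. -/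
theorem codeAverage_tailPart_enumHom_le (G : SimpleGraph V) {K M M' : ℕ}
    (hK : ∀ i < M', RootedGraph.enumDegree i ≤ K) :
    codeAverage G (tailPart M fun i => (RootedGraph.enumHom i : ℝ)) ≤
      (K + 1) * codeAverage G (tailPart M fun i => (RootedGraph.enumDegree i : ℝ) ^ 3) +
        codeAverage G (tailPart M' fun i => (RootedGraph.enumDegree i : ℝ) ^ 3) := by
  unfold codeAverage
  rw [← mul_div_assoc, ← add_div]
  gcongr ?_ / _
  set d : V → ℝ := fun x => (vertexDegree G x : ℝ) with hd
  set p : V → ℝ := fun x => if vertexCode G x < M then 0 else 1 with hp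
  set q : V → ℝ := fun x => if vertexCode G x < M' then 0 else 1 with hq
  have hp0 : ∀ x, 0 ≤ p x := fun x => by simp only [hp]; split_ifs <;> norm_num
  have hp1 : ∀ x, p x ≤ 1 := fun x => by simp only [hp]; split_ifs <;> norm_num
  have hq0 : ∀ x, 0 ≤ q x := fun x => by simp only [hq]; split_ifs <;> norm_num
  have hd0 : ∀ x, 0 ≤ d x := fun x => by simp only [hd]; positivity
  have hd1 : ∀ x, d x ≤ d x ^ 2 := fun x => by
    simp only [hd]
    exact_mod_cast Nat.le_self_pow two_ne_zero _
  have e1 : ∀ x, tailPart M (fun i => (RootedGraph.enumHom i : ℝ)) (vertexCode G x) =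
      ∑ y, adjWeight G x y * (p x * (d x * d y)) := fun x => by
    simp only [tailPart, enumHom_vertexCode_eq_sum, hp]
    split_ifs <;> simp [hd]
  have e2 : ∀ x, tailPart M (fun i => (RootedGraph.enumDegree i : ℝ) ^ 3) (vertexCode G x) =
      d x * (p x * d x ^ 2) := fun x => by
    simp only [tailPart, enumDegree_vertexCode, hp]
    split_ifs
    · simp
    · simp only [hd]; ring
  have e3 : ∀ x, tailPart M' (fun i => (RootedGraph.enumDegree i : ℝ) ^ 3) (vertexCode G x) =
      d x * (q x * d x ^ 2) := fun x => by
    simp only [tailPart, enumDegree_vertexCode, hq]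
    split_ifs
    · simp
    · simp only [hd]; ring
  simp only [e1, e2, e3]
  rw [← sum_adjWeight_left G fun x => p x * d x ^ 2,
    ← sum_adjWeight_right G fun x => q x * d x ^ 2, Finset.mul_sum, ← Finset.sum_add_distrib]
  refine Finset.sum_le_sum fun x _ => ?_
  rw [Finset.mul_sum, ← Finset.sum_add_distrib]
  refine Finset.sum_le_sum fun y _ => ?_
  -- `p` and `q` indicate index at least `M` and at least `M'`. If `y` has index below `M'`, then
  -- d(y) ≤ K and d(x) ≤ d(x)², as degrees are integers. Otherwise `q y = 1` and d(x) d(y) ≤ d(x)² +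
  -- d(y)²; the 1 in `K + 1` pays for this d(x)².
  have key : p x * (d x * d y) ≤ (K + 1) * (p x * d x ^ 2) + q y * d y ^ 2 := by
    by_cases hy : vertexCode G y < M'
    · have hdy : d y ≤ K := by
        have := hK _ hy
        rw [enumDegree_vertexCode] at this
        exact Nat.cast_le.2 this
      have h1 : p x * (d x * d y) ≤ p x * (d x ^ 2 * K) := by
        refine mul_le_mul_of_nonneg_left ?_ (hp0 x)
        exact mul_le_mul (hd1 x) hdy (hd0 y) (sq_nonneg _)
      nlinarith [mul_nonneg (hp0 x) (sq_nonneg (d x)), mul_nonneg (hq0 y) (sq_nonneg (d y))]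
    · have hqy : q y = 1 := if_neg hy
      have h1 : p x * (d x * d y) ≤ p x * (d x ^ 2 + d y ^ 2) := by
        refine mul_le_mul_of_nonneg_left ?_ (hp0 x)
        nlinarith [sq_nonneg (d x - d y), sq_nonneg (d x), sq_nonneg (d y)]
      have h2 : p x * d y ^ 2 ≤ 1 * d y ^ 2 := mul_le_mul_of_nonneg_right (hp1 x) (sq_nonneg _)
      have h3 : 0 ≤ (K : ℝ) * (p x * d x ^ 2) :=
        mul_nonneg (Nat.cast_nonneg K) (mul_nonneg (hp0 x) (sq_nonneg _))
      rw [hqy]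
      linarith
  have := mul_le_mul_of_nonneg_left key (adjWeight_nonneg G x y)
  linarith

end Finite

/-! ### Convergence in probability and in mean -/

section Prob

variable {Ω : ℕ → Type u} [∀ n, MeasurableSpace (Ω n)] {P : ∀ n, Measure (Ω n)}

theorem measurable_comp_graph {Ω : Type u} [MeasurableSpace Ω] {V : Type v} [Fintype V]
    {G : Ω → SimpleGraph V} (hG : ∀ K, MeasurableSet {ω | G ω = K}) (φ : SimpleGraph V → ℝ) :
    Measurable fun ω => φ (G ω) := by
  let _ : MeasurableSpace (SimpleGraph V) := ⊤
  have h : Measurable G := measurable_to_countable' hG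
  exact measurable_from_top.comp h

/-- There are finitely many graphs on a finite vertex set, so every real function of the random
graph is bounded. -/
theorem integrable_comp_graph {Ω : Type u} [MeasurableSpace Ω] {P : Measure Ω}
    [IsProbabilityMeasure P] {V : Type v} [Fintype V]
    {G : Ω → SimpleGraph V} (hG : ∀ K, MeasurableSet {ω | G ω = K}) (φ : SimpleGraph V → ℝ) :
    Integrable (fun ω => φ (G ω)) P := by
  obtain ⟨C, hC⟩ := (Set.finite_range fun K => ‖φ K‖).bddAbove
  exact .of_bound (measurable_comp_graph hG φ).aestronglyMeasurable C
    (.of_forall fun ω => hC ⟨G ω, rfl⟩)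

/-- Bounded convergence: splitting at |X - c| = ε gives E|X - c| ≤ ε + C P(|X - c| > ε). The
probability space may vary with `n`. -/
theorem TendstoInProb.tendsto_integral_abs_sub [∀ n, IsProbabilityMeasure (P n)]
    {X : ∀ n, Ω n → ℝ} {c C : ℝ} (h : TendstoInProb P X c) (hX : ∀ n, Measurable (X n))
    (hC : ∀ n ω, |X n ω - c| ≤ C) :
    Tendsto (fun n => ∫ ω, |X n ω - c| ∂(P n)) atTop (𝓝 0) := by
  have hmeas : ∀ n, Measurable fun ω => |X n ω - c| := fun n =>
    ((hX n).sub_const c).abs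
  have hle : ∀ ε : ℝ, 0 < ε → ∀ n,
      ∫ ω, |X n ω - c| ∂(P n) ≤ ε + C * (P n).real {ω | ε < |X n ω - c|} := by
    intro ε hε n
    have hs : MeasurableSet {ω | ε < |X n ω - c|} := measurableSet_lt measurable_const (hmeas n)
    have hi : Integrable ({ω | ε < |X n ω - c|}.indicator fun _ => C) (P n) :=
      (integrable_const C).indicator hs
    have h1 : ∫ ω, (ε + {ω | ε < |X n ω - c|}.indicator (fun _ => C) ω) ∂(P n) =
        ε + C * (P n).real {ω | ε < |X n ω - c|} := by
      rw [integral_add (integrable_const ε) hi, integral_indicator_const C hs]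
      simp [mul_comm]
    rw [← h1]
    refine integral_mono_of_nonneg (.of_forall fun ω => abs_nonneg _)
      ((integrable_const ε).add hi) (.of_forall fun ω => ?_)
    by_cases hω : ε < |X n ω - c|
    · have : ω ∈ {ω | ε < |X n ω - c|} := hω
      simp only [Set.indicator_of_mem this]
      linarith [hC n ω]
    · have : ω ∉ {ω | ε < |X n ω - c|} := hω
      simp only [Set.indicator_of_notMem this]
      linarith
  rw [Metric.tendsto_atTop']
  intro ε hε
  have h0 : Tendsto (fun n => ε / 2 + C * (P n).real {ω | ε / 2 < |X n ω - c|}) atTop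
      (𝓝 (ε / 2 + C * 0)) :=
    (((ENNReal.tendsto_toReal ENNReal.zero_ne_top).comp (h (ε / 2) (by positivity))).const_mul
      C).const_add _
  obtain ⟨N, hN⟩ := eventually_atTop.1 (h0.eventually (gt_mem_nhds (by linarith : _ < ε)))
  refine ⟨N, fun n hn => ?_⟩
  rw [dist_zero_right, Real.norm_of_nonneg (integral_nonneg fun ω => abs_nonneg _)]
  exact (hle (ε / 2) (by positivity) n).trans_lt (hN n hn.le)

/-- Markov's inequality. -/
theorem tendstoInProb_of_tendsto_integral [∀ n, IsProbabilityMeasure (P n)]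
    {X : ∀ n, Ω n → ℝ} {c : ℝ} (hX : ∀ n, Integrable (X n) (P n))
    (h : Tendsto (fun n => ∫ ω, |X n ω - c| ∂(P n)) atTop (𝓝 0)) :
    TendstoInProb P X c := by
  intro ε hε
  have hb : ∀ n, (P n).real {ω | ε < |X n ω - c|} ≤ (∫ ω, |X n ω - c| ∂(P n)) / ε := by
    intro n
    rw [le_div_iff₀' hε]
    have h1 := mul_meas_ge_le_integral_of_nonneg (μ := P n) (f := fun ω => |X n ω - c|)
      (.of_forall fun ω => abs_nonneg _) ((hX n).sub (integrable_const c)).abs ε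
    refine le_trans (mul_le_mul_of_nonneg_left ?_ hε.le) h1
    exact measureReal_mono fun ω (hω : ε < |X n ω - c|) => hω.le
  have h0 : Tendsto (fun n => (P n).real {ω | ε < |X n ω - c|}) atTop (𝓝 0) :=
    squeeze_zero (fun n => measureReal_nonneg) hb (by simpa using h.div_const ε)
  rw [← ENNReal.tendsto_toReal_iff (fun n => measure_ne_top _ _) ENNReal.zero_ne_top]
  exact h0

theorem tendsto_integral_of_tendsto_integral_abs_sub [∀ n, IsProbabilityMeasure (P n)]
    {X : ∀ n, Ω n → ℝ} {c : ℝ} (hX : ∀ n, Integrable (X n) (P n))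
    (h : Tendsto (fun n => ∫ ω, |X n ω - c| ∂(P n)) atTop (𝓝 0)) :
    Tendsto (fun n => ∫ ω, X n ω ∂(P n)) atTop (𝓝 c) := by
  rw [tendsto_iff_norm_sub_tendsto_zero]
  refine squeeze_zero (fun n => norm_nonneg _) (fun n => ?_) h
  have : (∫ ω, X n ω ∂(P n)) - c = ∫ ω, (X n ω - c) ∂(P n) := by
    rw [integral_sub (hX n) (integrable_const c)]
    simp
  rw [this]
  exact norm_integral_le_integral_norm _

theorem TendstoInProb.comp₂ {X Y : ∀ n, Ω n → ℝ} {a b : ℝ} (hX : TendstoInProb P X a)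
    (hY : TendstoInProb P Y b) {f : ℝ → ℝ → ℝ}
    (hf : ContinuousAt (fun p : ℝ × ℝ => f p.1 p.2) (a, b)) :
    TendstoInProb P (fun n ω => f (X n ω) (Y n ω)) (f a b) := by
  intro ε hε
  obtain ⟨δ, hδ, h⟩ := Metric.continuousAt_iff.1 hf ε hε
  have hδ' : 0 < δ / 2 := by positivity
  have h0 := (hX (δ / 2) hδ').add (hY (δ / 2) hδ')
  rw [add_zero] at h0
  refine tendsto_of_tendsto_of_tendsto_of_le_of_le tendsto_const_nhds h0 (fun n => zero_le)
    fun n => le_trans (measure_mono fun ω hω => ?_) (measure_union_le _ _)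
  by_contra hc
  simp only [Set.mem_union, Set.mem_ofPred_eq, not_or, not_lt] at hc
  have := @h (X n ω, Y n ω) (by
    rw [Prod.dist_eq, max_lt_iff, Real.dist_eq, Real.dist_eq]
    exact ⟨by linarith [hc.1], by linarith [hc.2]⟩)
  exact absurd hω (not_lt.2 this.le)

end Prob

/-! ### Averages of local functions -/

theorem sum_headPart (M : ℕ) (f : ℕ → ℝ) (j : ℕ) :
    headPart M f j = ∑ i ∈ Finset.range M, if j = i then f i else 0 := by
  simp [headPart]

theorem ite_code_eq_indicator (i : ℕ) (a : ℝ) :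
    (fun x : GStar => if x.code = i then a else 0) =
      (GStar.code ⁻¹' {i}).indicator fun _ => a := by
  classical
  ext x
  simp [Set.indicator]

theorem measurable_comp_code (g : ℕ → ℝ) : Measurable fun x : GStar => g x.code :=
  (Measurable.of_discrete (f := g)).comp GStar.measurable_code

theorem integrable_ite_code (μ : Measure GStar) [IsProbabilityMeasure μ] (i : ℕ) (a : ℝ) :
    Integrable (fun x : GStar => if x.code = i then a else 0) μ := by
  rw [ite_code_eq_indicator]
  exact (integrable_const a).indicator (GStar.measurable_code (measurableSet_singleton i))

theorem integrable_headPart (μ : Measure GStar) [IsProbabilityMeasure μ] (M : ℕ) (f : ℕ → ℝ) :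
    Integrable (fun x : GStar => headPart M f x.code) μ := by
  simp only [sum_headPart]
  exact integrable_finsetSum _ fun i _ => integrable_ite_code μ i _

theorem integral_headPart (μ : Measure GStar) [IsProbabilityMeasure μ] (M : ℕ) (f : ℕ → ℝ) :
    ∫ x : GStar, headPart M f x.code ∂μ =
      ∑ i ∈ Finset.range M, f i * μ.real {x : GStar | x.code = i} := by
  simp only [sum_headPart]
  rw [integral_finsetSum _ fun i _ => integrable_ite_code μ i _]
  refine Finset.sum_congr rfl fun i _ => ?_
  rw [ite_code_eq_indicator,
    integral_indicator_const _ (GStar.measurable_code (measurableSet_singleton i)),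
    smul_eq_mul, mul_comm]
  rfl

theorem tendsto_integral_headPart {μ : Measure GStar} {f : ℕ → ℝ}
    (hf : Integrable (fun x : GStar => f x.code) μ) :
    Tendsto (fun M => ∫ x : GStar, headPart M f x.code ∂μ) atTop
      (𝓝 (∫ x : GStar, f x.code ∂μ)) := by
  refine tendsto_integral_of_dominated_convergence (fun x => ‖f x.code‖) (fun M => ?_) hf.norm
    (fun M => .of_forall fun x => ?_) (.of_forall fun x => ?_)
  · exact (measurable_comp_code _).aestronglyMeasurable
  · unfold headPart
    split_ifs <;> simp
  · refine tendsto_const_nhds.congr' ?_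
    filter_upwards [eventually_gt_atTop x.code] with M hM
    exact (if_pos hM).symm

/-- Monotone convergence: for `f ≥ 0` the truncations increase to `f`, so a uniform bound on their
means bounds the mean of `f`. -/
theorem integrable_of_integral_headPart_le {μ : Measure GStar} [IsProbabilityMeasure μ] {f : ℕ → ℝ}
    (hf : ∀ i, 0 ≤ f i) {C : ℝ} (hC : ∀ M, ∫ x : GStar, headPart M f x.code ∂μ ≤ C) :
    Integrable (fun x : GStar => f x.code) μ := by
  refine ⟨(measurable_comp_code f).aestronglyMeasurable, ?_⟩
  rw [hasFiniteIntegral_iff_ofReal (.of_forall fun x => hf _)]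
  have hmono : Tendsto (fun M => ∫⁻ x : GStar, ENNReal.ofReal (headPart M f x.code) ∂μ) atTop
      (𝓝 (∫⁻ x : GStar, ENNReal.ofReal (f x.code) ∂μ)) := by
    refine lintegral_tendsto_of_tendsto_of_monotone
      (fun M => (measurable_comp_code _).ennreal_ofReal.aemeasurable)
      (.of_forall fun x M N hMN => ?_)
      (.of_forall fun x => ?_)
    · refine ENNReal.ofReal_le_ofReal ?_
      unfold headPart
      split_ifs with h1 h2
      · exact le_rfl
      · omega
      · exact hf _
      · exact le_rfl
    · refine tendsto_const_nhds.congr' ?_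
      filter_upwards [eventually_gt_atTop x.code] with M hM
      rw [headPart, if_pos hM]
  refine (le_of_tendsto' hmono fun M => ?_).trans_lt (ENNReal.ofReal_lt_top (r := C))
  have h0 : ∀ i, 0 ≤ headPart M f i := fun i => by
    unfold headPart; split_ifs; exacts [hf i, le_rfl]
  rw [← ofReal_integral_eq_lintegral_ofReal (integrable_headPart μ M f) (.of_forall fun x => h0 _)]
  exact ENNReal.ofReal_le_ofReal (hC M)

/-! ### Averages of local functions under local weak convergence -/

section Local

variable {Ω : ℕ → Type u} [∀ n, MeasurableSpace (Ω n)] {P : ∀ n, Measure (Ω n)}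
  {V : ℕ → Type v} [∀ n, Fintype (V n)] {G : ∀ n, Ω n → SimpleGraph (V n)} {μ : Measure GStar}

/-- If `i` is the least index of its type, this is the hypothesis at radius 2; otherwise no ball has
code `i` and both sides vanish. -/
theorem LocallyConvergesInProb.tendstoInProb_code (h : LocallyConvergesInProb P G μ) (i : ℕ) :
    TendstoInProb P
      (fun n ω => ({x | vertexCode (G n ω) x = i}.ncard : ℝ) / (Fintype.card (V n) : ℝ))
      (μ.real {x : GStar | x.code = i}) := by
  by_cases hi : (RootedGraph.enum i).code = i
  · have := h 2 (RootedGraph.enum i) (RootedGraph.finite_enum i) (RootedGraph.connected_enum i)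
    simpa only [ballFraction, vertexCode_eq_iff, GStar.code_eq_iff, hi, and_true] using this
  · simp only [vertexCode_eq_iff, GStar.code_eq_iff, hi, and_false, Set.ofPred_false,
      Set.ncard_empty, Nat.cast_zero, zero_div, measureReal_empty]
    intro ε hε
    simp [not_lt.2 hε.le]

variable [∀ n, IsProbabilityMeasure (P n)]

theorem tendsto_codeAverage_headPart [IsProbabilityMeasure μ]
    (hG : ∀ (n : ℕ) (K : SimpleGraph (V n)), MeasurableSet {ω | G n ω = K})
    (h : LocallyConvergesInProb P G μ) (M : ℕ) (f : ℕ → ℝ) :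
    Tendsto (fun n => ∫ ω, |codeAverage (G n ω) (headPart M f) -
      ∫ x : GStar, headPart M f x.code ∂μ| ∂(P n)) atTop (𝓝 0) := by
  set q : ℕ → ∀ n, SimpleGraph (V n) → ℝ := fun i n K =>
    ({x | vertexCode K x = i}.ncard : ℝ) / (Fintype.card (V n) : ℝ) with hq
  set ν : ℕ → ℝ := fun i => μ.real {x : GStar | x.code = i} with hν
  have hq01 : ∀ i n K, |q i n K - ν i| ≤ 1 := by
    intro i n K
    have h1 : q i n K ≤ 1 := by
      refine div_le_one_of_le₀ ?_ (Nat.cast_nonneg _)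
      rw [← Nat.card_eq_fintype_card]
      exact_mod_cast Set.ncard_le_card _
    have h2 : 0 ≤ q i n K := by positivity
    have h3 : ν i ≤ 1 := measureReal_le_one
    have h4 : 0 ≤ ν i := measureReal_nonneg
    rw [abs_le]; constructor <;> linarith
  have hL : ∀ i, Tendsto (fun n => ∫ ω, |q i n (G n ω) - ν i| ∂(P n)) atTop (𝓝 0) := fun i =>
    (h.tendstoInProb_code i).tendsto_integral_abs_sub
      (fun n => measurable_comp_graph (hG n) (q i n)) fun n ω => hq01 i n _
  have hsum : Tendsto (fun n => ∑ i ∈ Finset.range M,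
      |f i| * ∫ ω, |q i n (G n ω) - ν i| ∂(P n)) atTop (𝓝 0) := by
    have := tendsto_finsetSum (Finset.range M) fun i _ => (hL i).const_mul |f i|
    simpa using this
  refine squeeze_zero (fun n => integral_nonneg fun ω => abs_nonneg _) (fun n => ?_) hsum
  have hint : ∀ i, Integrable (fun ω => |f i| * |q i n (G n ω) - ν i|) (P n) := fun i =>
    integrable_comp_graph (hG n) fun K => |f i| * |q i n K - ν i|
  simp_rw [← integral_const_mul]
  rw [← integral_finsetSum _ fun i _ => hint i]
  refine integral_mono_of_nonneg (.of_forall fun ω => abs_nonneg _)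
    (integrable_finsetSum _ fun i _ => hint i) (.of_forall fun ω => ?_)
  simp only
  rw [codeAverage_headPart, integral_headPart, ← Finset.sum_sub_distrib]
  refine (Finset.abs_sum_le_sum_abs _ _).trans (Finset.sum_le_sum fun i _ => ?_)
  rw [← mul_sub, abs_mul]

theorem tendsto_integral_codeAverage_headPart [IsProbabilityMeasure μ]
    (hG : ∀ (n : ℕ) (K : SimpleGraph (V n)), MeasurableSet {ω | G n ω = K})
    (h : LocallyConvergesInProb P G μ) (M : ℕ)
    (f : ℕ → ℝ) : Tendsto (fun n => ∫ ω, codeAverage (G n ω) (headPart M f) ∂(P n)) atTop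
      (𝓝 (∫ x : GStar, headPart M f x.code ∂μ)) :=
  tendsto_integral_of_tendsto_integral_abs_sub
    (fun n => integrable_comp_graph (hG n) fun K => codeAverage K _)
    (tendsto_codeAverage_headPart hG h M f)

theorem integral_codeAverage_head_add_tail
    (hG : ∀ (n : ℕ) (K : SimpleGraph (V n)), MeasurableSet {ω | G n ω = K})
    (n M : ℕ) (f : ℕ → ℝ) :
    ∫ ω, codeAverage (G n ω) f ∂(P n) = ∫ ω, codeAverage (G n ω) (headPart M f) ∂(P n) +
      ∫ ω, codeAverage (G n ω) (tailPart M f) ∂(P n) := by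
  rw [← integral_add (integrable_comp_graph (hG n) fun K => codeAverage K (headPart M f))
    (integrable_comp_graph (hG n) fun K => codeAverage K (tailPart M f))]
  simp only [← codeAverage_add, headPart_add_tailPart]

/-- Convergence of the mean to the mean of the limit implies uniform integrability. -/
theorem eventually_integral_tailPart_le [IsProbabilityMeasure μ]
    (hG : ∀ (n : ℕ) (K : SimpleGraph (V n)), MeasurableSet {ω | G n ω = K})
    (h : LocallyConvergesInProb P G μ) {f : ℕ → ℝ}
    (hf : Integrable (fun x : GStar => f x.code) μ)
    (hm : Tendsto (fun n => ∫ ω, codeAverage (G n ω) f ∂(P n)) atTop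
      (𝓝 (∫ x : GStar, f x.code ∂μ))) {ε : ℝ} (hε : 0 < ε) :
    ∀ᶠ M in atTop, ∀ᶠ n in atTop, ∫ ω, codeAverage (G n ω) (tailPart M f) ∂(P n) ≤ ε := by
  have h1 := (tendsto_integral_headPart hf).eventually
    (lt_mem_nhds (sub_lt_self (∫ x : GStar, f x.code ∂μ) hε))
  filter_upwards [h1] with M hM
  -- The mean of the tail is the total mean minus that of the head. Its limit is the mean of the
  -- tail under `μ`, which is below ε by the choice of `M`.
  have h2 := hm.sub (tendsto_integral_codeAverage_headPart hG h M f)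
  filter_upwards [h2.eventually (gt_mem_nhds (by linarith : _ < ε))] with n hn
  rw [integral_codeAverage_head_add_tail hG n M f] at hn
  linarith

/-- Local convergence and uniform integrability imply convergence in mean. -/
theorem tendsto_codeAverage [IsProbabilityMeasure μ]
    (hG : ∀ (n : ℕ) (K : SimpleGraph (V n)), MeasurableSet {ω | G n ω = K})
    (h : LocallyConvergesInProb P G μ) {f : ℕ → ℝ} (hf0 : ∀ i, 0 ≤ f i)
    (hf : Integrable (fun x : GStar => f x.code) μ)
    (htail : ∀ ε : ℝ, 0 < ε → ∀ᶠ M in atTop, ∀ᶠ n in atTop,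
      ∫ ω, codeAverage (G n ω) (tailPart M f) ∂(P n) ≤ ε) :
    Tendsto (fun n => ∫ ω, |codeAverage (G n ω) f - ∫ x : GStar, f x.code ∂μ| ∂(P n))
      atTop (𝓝 0) := by
  set c := ∫ x : GStar, f x.code ∂μ with hc
  rw [tendsto_order]
  refine ⟨fun a ha => .of_forall fun n => ha.trans_le (integral_nonneg fun ω => abs_nonneg _),
    fun ε hε => ?_⟩
  -- Three errors of at most ε / 4 arise: the fluctuation of the head, the tail in the finite graph,
  -- and the truncation of the limit.
  have hε4 : 0 < ε / 4 := by positivity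
  obtain ⟨M, hM1, hM2⟩ := ((htail (ε / 4) hε4).and ((tendsto_integral_headPart hf).eventually
    (Metric.ball_mem_nhds c hε4))).exists
  set cM := ∫ x : GStar, headPart M f x.code ∂μ with hcM
  filter_upwards [hM1, (tendsto_codeAverage_headPart hG h M f).eventually (gt_mem_nhds hε4)]
    with n hn1 hn2
  have hM2' : |cM - c| < ε / 4 := hM2
  have i1 := integrable_comp_graph (P := P n) (hG n) fun K => |codeAverage K (headPart M f) - cM|
  have i2 := integrable_comp_graph (P := P n) (hG n) fun K => codeAverage K (tailPart M f)
  have hle : ∫ ω, |codeAverage (G n ω) f - c| ∂(P n) ≤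
      ∫ ω, (|codeAverage (G n ω) (headPart M f) - cM| + codeAverage (G n ω) (tailPart M f) +
        |cM - c|) ∂(P n) := by
    refine integral_mono_of_nonneg (.of_forall fun ω => abs_nonneg _)
      ((i1.add i2).add (integrable_const _)) (.of_forall fun ω => ?_)
    have e : codeAverage (G n ω) f = codeAverage (G n ω) (headPart M f) +
        codeAverage (G n ω) (tailPart M f) := by
      simp only [← codeAverage_add, headPart_add_tailPart]
    have ht : 0 ≤ codeAverage (G n ω) (tailPart M f) := by
      refine div_nonneg (Finset.sum_nonneg fun x _ => ?_) (Nat.cast_nonneg _)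
      unfold tailPart
      split_ifs
      exacts [le_rfl, hf0 _]
    simp only
    calc |codeAverage (G n ω) f - c|
        = |(codeAverage (G n ω) (headPart M f) - cM) + codeAverage (G n ω) (tailPart M f) +
            (cM - c)| := by rw [e]; ring_nf
      _ ≤ _ := abs_add_three _ _ _
      _ = _ := by rw [abs_of_nonneg ht]
  have e := integral_add (i1.add i2) (integrable_const (μ := P n) |cM - c|)
  simp only [Pi.add_apply] at e
  rw [e, integral_add i1 i2] at hle
  simp only [integral_const, probReal_univ, one_smul] at hle
  linarith

end Local

/-! ### Convergence of the assortativity coefficient -/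

theorem mainTheorem6
    {Ω : ℕ → Type u} [∀ n, MeasurableSpace (Ω n)]
    (P : ∀ n, Measure (Ω n)) [∀ n, IsProbabilityMeasure (P n)]
    {V : ℕ → Type v} [∀ n, Fintype (V n)] [∀ n, Nonempty (V n)]
    (hV : Tendsto (fun n => Fintype.card (V n)) atTop atTop)
    -- the random graphs `G n` with vertex set `V n`
    (G : ∀ n, Ω n → SimpleGraph (V n))
    (hG : ∀ (n : ℕ) (K : SimpleGraph (V n)), MeasurableSet {ω | G n ω = K})
    -- the law of the limit `G*`
    (μ : Measure GStar) [IsProbabilityMeasure μ]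
    (hconv : LocallyConvergesInProb P G μ)
    (hint : Integrable (fun x : GStar => (x.degree : ℝ) ^ 3) μ)
    (hmom : Tendsto (fun n => ∫ ω, degreeMoment (G n ω) 3 ∂(P n)) atTop
      (𝓝 (∫ x : GStar, (x.degree : ℝ) ^ 3 ∂μ)))
    (hvar : 0 < Var[fun x : GStar => (x.degree : ℝ); μ])
    -- the denominator of the limit is nonzero
    (hden : (∫ x : GStar, (x.degree : ℝ) ∂μ) * (∫ x : GStar, (x.degree : ℝ) ^ 3 ∂μ)
      - (∫ x : GStar, (x.degree : ℝ) ^ 2 ∂μ) ^ 2 ≠ 0)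
    (ρ : ℝ)
    (hρ : ρ = ((∫ x : GStar, (x.degree : ℝ) ∂μ)
          * (∫ x : GStar, (x.homCount (SimpleGraph.pathGraph 4) 1 : ℝ) ∂μ)
        - (∫ x : GStar, (x.degree : ℝ) ^ 2 ∂μ) ^ 2)
      / ((∫ x : GStar, (x.degree : ℝ) ∂μ) * (∫ x : GStar, (x.degree : ℝ) ^ 3 ∂μ)
        - (∫ x : GStar, (x.degree : ℝ) ^ 2 ∂μ) ^ 2)) :
    Integrable (fun x : GStar => (x.homCount (SimpleGraph.pathGraph 4) 1 : ℝ)) μ ∧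
      TendstoInProb P (fun n ω => assortativity (G n ω)) ρ ∧
      Tendsto (fun n => ∫ ω, assortativity (G n ω) ∂(P n)) atTop (𝓝 ρ) := by
  set D : ℕ → ℝ := fun i => (RootedGraph.enumDegree i : ℝ) ^ 3 with hD
  set F : ℕ → ℝ := fun i => (RootedGraph.enumHom i : ℝ) with hF
  have hF0 : ∀ i, 0 ≤ F i := fun i => Nat.cast_nonneg _
  have hDint : Integrable (fun x : GStar => D x.code) μ := by
    simpa only [hD, GStar.enumDegree_code] using hint
  have hDmom : Tendsto (fun n => ∫ ω, codeAverage (G n ω) D ∂(P n)) atTop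
      (𝓝 (∫ x : GStar, D x.code ∂μ)) := by
    simpa only [hD, GStar.enumDegree_code, degreeMoment_eq_codeAverage] using hmom
  have hDtail : ∀ ε : ℝ, 0 < ε → ∀ᶠ M in atTop, ∀ᶠ n in atTop,
      ∫ ω, codeAverage (G n ω) (tailPart M D) ∂(P n) ≤ ε := fun ε hε =>
    eventually_integral_tailPart_le hG hconv hDint hDmom hε
  have hI : ∀ n f, Integrable (fun ω => codeAverage (G n ω) f) (P n) := fun n f =>
    integrable_comp_graph (hG n) fun K => codeAverage K f
  -- the moments of the degree
  have hmoment : ∀ k ∈ Finset.Icc 1 3,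
      TendstoInProb P (fun n ω => degreeMoment (G n ω) k) (∫ x : GStar, (x.degree : ℝ) ^ k ∂μ) := by
    intro k hk
    rw [Finset.mem_Icc] at hk
    -- Degrees are natural numbers, so d^k ≤ d³; degree 0 is where `k ≠ 0` is needed.
    have hle : ∀ i, (RootedGraph.enumDegree i : ℝ) ^ k ≤ D i := fun i => by
      rcases Nat.eq_zero_or_pos (RootedGraph.enumDegree i) with h0 | h0
      · simp [hD, h0, zero_pow (by omega : k ≠ 0)]
      · exact pow_le_pow_right₀ (by exact_mod_cast h0) hk.2
    have h := tendsto_codeAverage (f := fun i => (RootedGraph.enumDegree i : ℝ) ^ k) hG hconv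
      (fun i => by positivity)
      (hDint.mono' (measurable_comp_code fun i =>
        (RootedGraph.enumDegree i : ℝ) ^ k).aestronglyMeasurable (.of_forall fun x => by
          rw [Real.norm_of_nonneg (by positivity)]; exact hle _))
      (fun ε hε => (hDtail ε hε).mono fun M hM => hM.mono fun n hn =>
        (integral_mono (hI n _) (hI n _) fun ω => codeAverage_mono _ fun i => by
          unfold tailPart; split_ifs; exacts [le_rfl, hle i]).trans hn)
    have h' := tendstoInProb_of_tendsto_integral (fun n => hI n _) h
    simpa only [GStar.enumDegree_code, degreeMoment_eq_codeAverage] using h'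
  -- the paths on four vertices
  have hFint : Integrable (fun x : GStar => F x.code) μ := by
    -- Each truncated mean under `μ` is the limit of its finite counterparts, which are at most the
    -- third moments of the degree; these converge to `C`.
    refine integrable_of_integral_headPart_le hF0 (C := ∫ x : GStar, D x.code ∂μ) fun M => ?_
    refine le_of_tendsto_of_tendsto' (tendsto_integral_codeAverage_headPart hG hconv M F) hDmom
      fun n => integral_mono (hI n _) (hI n _) fun ω => ?_
    refine (codeAverage_mono _ fun i => ?_).trans (codeAverage_enumHom_le (G n ω))
    unfold headPart
    split_ifs
    exacts [le_rfl, hF0 i]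
  have hFtail : ∀ ε : ℝ, 0 < ε → ∀ᶠ M in atTop, ∀ᶠ n in atTop,
      ∫ ω, codeAverage (G n ω) (tailPart M F) ∂(P n) ≤ ε := by
    intro ε hε
    -- The order of choices matters: `M'` makes one tail at most ε / 2, `K` bounds the degree over
    -- the finitely many types below `M'`, and only then is `M` taken large enough to absorb the
    -- factor `K + 1`.
    obtain ⟨M', hM'⟩ := (hDtail (ε / 2) (by positivity)).exists
    obtain ⟨K, hK⟩ : ∃ K : ℕ, ∀ i < M', RootedGraph.enumDegree i ≤ K :=
      ⟨(Finset.range M').sup RootedGraph.enumDegree, fun i hi =>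
        Finset.le_sup (Finset.mem_range.2 hi)⟩
    filter_upwards [hDtail (ε / (2 * (K + 1))) (by positivity)] with M hM
    filter_upwards [hM', hM] with n h1 h2
    have h3 : ∫ ω, codeAverage (G n ω) (tailPart M F) ∂(P n) ≤
        ∫ ω, ((K + 1) * codeAverage (G n ω) (tailPart M D) +
          codeAverage (G n ω) (tailPart M' D)) ∂(P n) :=
      integral_mono (hI n _) (((hI n _).const_mul _).add (hI n _)) fun ω =>
        codeAverage_tailPart_enumHom_le (G n ω) hK
    rw [integral_add ((hI n _).const_mul _) (hI n _), integral_const_mul] at h3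
    have h4 : ((K : ℝ) + 1) * ∫ ω, codeAverage (G n ω) (tailPart M D) ∂(P n) ≤ ε / 2 := by
      refine (mul_le_mul_of_nonneg_left h2 (by positivity)).trans_eq ?_
      field_simp
    linarith
  have hh : TendstoInProb P (fun n ω => codeAverage (G n ω) F)
      (∫ x : GStar, (x.homCount (SimpleGraph.pathGraph 4) 1 : ℝ) ∂μ) := by
    have h := tendstoInProb_of_tendsto_integral (fun n => hI n _)
      (tendsto_codeAverage hG hconv hF0 hFint hFtail)
    simpa only [hF, GStar.enumHom_code] using h
  have h1 := hmoment 1 (by simp)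
  have h2 := hmoment 2 (by simp)
  have h3 := hmoment 3 (by simp)
  simp only [pow_one] at h1
  have hr : TendstoInProb P (fun n ω => assortativity (G n ω)) ρ := by
    have hnum := (h1.comp₂ hh (f := fun a b => a * b) (by fun_prop)).comp₂ h2
      (f := fun a b => a - b ^ 2) (by fun_prop)
    have hdenom := (h1.comp₂ h3 (f := fun a b => a * b) (by fun_prop)).comp₂ h2
      (f := fun a b => a - b ^ 2) (by fun_prop)
    -- Only continuity at the limit point is required, so degenerate denominators at finite `n` do
    -- no harm.
    have := hnum.comp₂ hdenom (f := fun a b => a / b)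
      (continuousAt_fst.div continuousAt_snd hden)
    rw [hρ]
    simpa only [assortativity_eq] using this
  refine ⟨by simpa only [hF, GStar.enumHom_code] using hFint, hr, ?_⟩
  refine tendsto_integral_of_tendsto_integral_abs_sub
    (fun n => integrable_comp_graph (hG n) assortativity)
    (hr.tendsto_integral_abs_sub (C := 1 + |ρ|)
      (fun n => measurable_comp_graph (hG n) assortativity) fun n ω => ?_)
  exact (abs_sub _ _).trans (add_le_add (abs_assortativity_le_one _) le_rfl)
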